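/- Let $G$ be a compact metric tree: finitely many edges $e$, each identified with a compact interval $[0,|e|]$ of length $|e|>0$, whose ends are glued together at finitely many vertices so that the resulting graph is connected and has no cycles; $G$ carries its path metric. For a bounded measurable $q:G\to\mathbb{R}$ consider the Schrödinger operator $Hu=-u''+qu$ in $L^2(G)$ on the functions $u$ that are continuous on $G$, belong to $W^{2,2}(e)$ for every edge $e$, and satisfy the Kirchhoff condition at every vertex (the derivatives of $u$ along the incident edge ends, in the direction pointing into the vertex, sum to zero). Let $\lambda_1(G,q)<\lambda_2(G,q)\le\dots$ be its eigenvalues, counted with multiplicity, and let $\Gamma[q]=\lambda_2(G,q)-\lambda_1(G,q)$. For $M>0$ let $C_{G,M}$ be the set of all $q:G\to\mathbb{R}$ such that, on every path in $G$ from one leaf (vertex of degree one) to another, $q$ is convex (the path being regarded as an interval) and $0\le q\le M$. If there is an eigenfunction of the Laplacian (the case $q=0$) corresponding to $\lambda_2(G,0)$ which vanishes identically on an edge of $G$, then, for every $M>0$, the potential $q=0$ does not minimize $\Gamma$ in $C_{G,M}$; that is, there is $q\in C_{G,M}$ with $\Gamma[q]<\Gamma[0]$. -/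

import Mathlib

open Set MeasureTheory
open scoped ENNReal

noncomputable section

/-- The data of a metric graph with edge set `E`: every edge `e` is a compact interval
`[0, len e]` of positive length, and the ends of the edges (`0` and `len e`) are partitioned into
classes, the vertices. `src e` and `tgt e` are the vertices of the ends `0` and `len e` of `e`. -/
structure MetricGraph (V E : Type*) where
  src : E → V
  tgt : E → V
  len : E → ℝ
  len_pos : ∀ e, 0 < len e
  exists_incident : ∀ v, ∃ e, src e = v ∨ tgt e = v

namespace MetricGraph

variable {V E : Type*}

/-- The points of the metric graph: the edges glued at their ends, that is, the vertices together
with the interior points of the edges. -/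
inductive Point (G : MetricGraph V E) where
  | vertex (v : V) : Point G
  | interior (e : E) (s : Ioo (0 : ℝ) (G.len e)) : Point G

open Classical in
/-- `G.pt e s` is the point of `G` with coordinate `s ∈ [0, len e]` on the edge `e`
(outside of `[0, len e]` the coordinate is clamped). -/
def pt (G : MetricGraph V E) (e : E) (s : ℝ) : G.Point :=
  if h0 : s ≤ 0 then .vertex (G.src e)
  else if h1 : G.len e ≤ s then .vertex (G.tgt e)
  else .interior e ⟨s, not_le.mp h0, not_le.mp h1⟩

/-- `G.Chain x y r`: one can go from `x` to `y` by finitely many moves, each of them inside a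
single edge, of total length `r`. -/
inductive Chain (G : MetricGraph V E) : G.Point → G.Point → ℝ → Prop
  | nil (x : G.Point) : Chain G x x 0
  | cons (e : E) (s t : ℝ) (hs : s ∈ Icc 0 (G.len e)) (ht : t ∈ Icc 0 (G.len e))
      (y : G.Point) (r : ℝ) (h : Chain G (G.pt e t) y r) : Chain G (G.pt e s) y (|s - t| + r)

namespace Chain

variable {G : MetricGraph V E}

theorem nonneg {x y : G.Point} {r : ℝ} (h : G.Chain x y r) : 0 ≤ r := by
  induction h with
  | nil x => exact le_rfl
  | cons e s t hs ht y r h ih => exact add_nonneg (abs_nonneg _) ih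

theorem append {x y z : G.Point} {r r' : ℝ} (h : G.Chain x y r) (h' : G.Chain y z r') :
    G.Chain x z (r + r') := by
  induction h with
  | nil x => simpa using h'
  | cons e s t hs ht y r h ih =>
    rw [add_assoc]
    exact Chain.cons e s t hs ht z _ (ih h')

theorem symm {x y : G.Point} {r : ℝ} (h : G.Chain x y r) : G.Chain y x r := by
  induction h with
  | nil x => exact Chain.nil x
  | cons e s t hs ht y r h ih =>
    have h1 := ih.append (Chain.cons e t s ht hs _ 0 (Chain.nil _))
    rwa [add_zero, add_comm, abs_sub_comm] at h1

end Chain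

/-- The natural (path) metric of a metric graph: the infimum of the lengths of all chains
between two points (infinite if there is none). Its topology is the one used on `G.Point`. -/
instance (G : MetricGraph V E) : PseudoEMetricSpace G.Point where
  edist x y := ⨅ (r : ℝ) (_ : G.Chain x y r), ENNReal.ofReal r
  edist_self x := by
    refine le_antisymm (iInf₂_le_of_le 0 (Chain.nil x) (by simp)) bot_le
  edist_comm x y := by
    refine le_antisymm ?_ ?_ <;>
      exact le_iInf₂ fun r h => iInf₂_le r h.symm
  edist_triangle x y z := by
    refine ENNReal.le_of_forall_pos_le_add fun ε hε hfin => ?_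
    have hx : (⨅ (r : ℝ) (_ : G.Chain x y r), ENNReal.ofReal r) ≠ ⊤ :=
      (ENNReal.add_lt_top.mp hfin).1.ne
    have hy : (⨅ (r : ℝ) (_ : G.Chain y z r), ENNReal.ofReal r) ≠ ⊤ :=
      (ENNReal.add_lt_top.mp hfin).2.ne
    have hε2 : ((ε / 2 : NNReal) : ℝ≥0∞) ≠ 0 := by
      simpa using hε.ne'
    have h1 := ENNReal.lt_add_right hx hε2
    have h2 := ENNReal.lt_add_right hy hε2
    simp only [iInf_lt_iff] at h1 h2
    obtain ⟨r, hr, hr'⟩ := h1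
    obtain ⟨s, hs, hs'⟩ := h2
    refine (iInf₂_le (r + s) (hr.append hs)).trans ?_
    rw [ENNReal.ofReal_add hr.nonneg hs.nonneg]
    refine (add_le_add hr'.le hs'.le).trans (le_of_eq ?_)
    have : (ε : ℝ≥0∞) = ((ε / 2 : NNReal) : ℝ≥0∞) + ((ε / 2 : NNReal) : ℝ≥0∞) := by
      rw [← ENNReal.coe_add, add_halves]
    rw [this]
    ring

/-- Adjacency of distinct vertices. -/
def toSimpleGraph (G : MetricGraph V E) : SimpleGraph V :=
  SimpleGraph.fromRel fun v w => ∃ e, G.src e = v ∧ G.tgt e = w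

/-- A tree: connected and without cycles (no loops, no parallel edges and no longer cycles). -/
def IsTree (G : MetricGraph V E) : Prop :=
  (∀ e, G.src e ≠ G.tgt e) ∧
  (∀ e e', s(G.src e, G.tgt e) = s(G.src e', G.tgt e') → e = e') ∧
  G.toSimpleGraph.IsTree

open Classical in
/-- The degree of a vertex: the number of edge ends at it. -/
def degree [Fintype E] (G : MetricGraph V E) (v : V) : ℕ :=
  (Finset.univ.filter fun e => G.src e = v).card + (Finset.univ.filter fun e => G.tgt e = v).card

/-- A leaf (boundary vertex) is a vertex of degree one. -/
def IsLeaf [Fintype E] (G : MetricGraph V E) (v : V) : Prop := G.degree v = 1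

/-- `f` is (the continuous representative of) an element of the Sobolev space `W^{1,2}(0, ℓ)`,
with derivative `g ∈ L²(0, ℓ)`. -/
def HasSobolevDeriv (ℓ : ℝ) (f g : ℝ → ℝ) : Prop :=
  MemLp g 2 (volume.restrict (Ioo 0 ℓ)) ∧
  ∀ x ∈ Icc (0 : ℝ) ℓ, f x = f 0 + ∫ t in (0 : ℝ)..x, g t

open Classical in
/-- The sum over all edge ends at the vertex `v` of the derivative in the direction pointing into
`v`, where `du e` is the derivative along the edge `e`. -/
def normalDerivSum [Fintype E] (G : MetricGraph V E) (du : E → ℝ → ℝ) (v : V) : ℝ :=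
  ∑ e, ((if G.src e = v then -du e 0 else 0) + (if G.tgt e = v then du e (G.len e) else 0))

/-- `u` is an eigenfunction of the Schrödinger operator `H u = -u'' + q u` with eigenvalue `μ`:
`u` is nonzero and in the domain of `H`, that is, continuous on `G`, in `W^{2,2}` of every edge and
satisfying the Kirchhoff condition at every vertex, and `-u'' + q u = μ u` almost everywhere. -/
def IsEigenfunction [Fintype E] (G : MetricGraph V E) (q : G.Point → ℝ) (μ : ℝ)
    (u : G.Point → ℝ) : Prop :=
  u ≠ 0 ∧ Continuous u ∧
  ∃ du ddu : E → ℝ → ℝ,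
    (∀ e, HasSobolevDeriv (G.len e) (fun s => u (G.pt e s)) (du e)) ∧
    (∀ e, HasSobolevDeriv (G.len e) (du e) (ddu e)) ∧
    (∀ v, G.normalDerivSum du v = 0) ∧
    (∀ e, ∀ᵐ s ∂(volume.restrict (Ioo 0 (G.len e))),
      -ddu e s + q (G.pt e s) * u (G.pt e s) = μ * u (G.pt e s))

/-- The `k`-th eigenvalue `λ_k(G, q)` (`k ≥ 1`) in increasing order and counted with multiplicity:
the least `μ` such that there are `k` linearly independent eigenfunctions with eigenvalues at
most `μ`. -/
def eigenvalue [Fintype E] (G : MetricGraph V E) (q : G.Point → ℝ) (k : ℕ) : ℝ :=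
  sInf {μ : ℝ | ∃ u : Fin k → G.Point → ℝ, LinearIndependent ℝ u ∧
    ∀ i, ∃ ν ≤ μ, G.IsEigenfunction q ν (u i)}

/-- The fundamental gap `Γ[q] = λ₂(q) - λ₁(q)`. -/
def gap [Fintype E] (G : MetricGraph V E) (q : G.Point → ℝ) : ℝ :=
  G.eigenvalue q 2 - G.eigenvalue q 1

/-- `P` is a path from `x` to `y`: the image of a continuous injective curve from `x` to `y`. -/
def IsPath (G : MetricGraph V E) (x y : G.Point) (P : Set G.Point) : Prop :=
  ∃ γ : ℝ → G.Point, ContinuousOn γ (Icc 0 1) ∧ InjOn γ (Icc 0 1) ∧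
    γ 0 = x ∧ γ 1 = y ∧ γ '' Icc 0 1 = P

/-- `q` is convex on the path `P`, regarded as an interval: it is convex in the coordinate given
by an isometry of an interval `[0, L]` onto `P`. (In a tree every path is isometric to an interval,
its arc length parametrization being an isometry.) -/
def ConvexOnPath (G : MetricGraph V E) (q : G.Point → ℝ) (P : Set G.Point) : Prop :=
  ∀ (L : ℝ) (c : ℝ → G.Point), Isometry ((Icc 0 L).domRestrict c) → c '' Icc 0 L = P →
    ConvexOn ℝ (Icc 0 L) (q ∘ c)

/-- The class `C_{G,M}` of a tree `G`: the potentials that are convex on, and take values in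
`[0, M]` on, every path from a boundary vertex to another one. -/
def convexClass [Fintype E] (G : MetricGraph V E) (M : ℝ) : Set (G.Point → ℝ) :=
  {q | ∀ v w, G.IsLeaf v → G.IsLeaf w → v ≠ w → ∀ P, G.IsPath (.vertex v) (.vertex w) P →
    G.ConvexOnPath q P ∧ ∀ x ∈ P, 0 ≤ q x ∧ q x ≤ M}

end MetricGraph

end

/-!
Removing the edge on which the eigenfunction vanishes disconnects the tree, and the eigenfunction
does not vanish identically on one of the two sides. Cut it off so that it vanishes on the other
side, whose vertex farthest from the first side is the free end of a pendant edge `f`. The function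
obtained is still an eigenfunction for `λ₂`, and it vanishes on `f`.

Let `t` be small and let the potential fall linearly along `f` from `t` at the free end to `0`, and
vanish elsewhere. It is convex along every path between leaves, since such a path can only meet the
free end of `f` at its own ends. The eigenfunction does not see the potential, so `λ₂` does not
increase, whereas `λ₁` becomes positive.

For the latter, a positive eigenfunction belongs to the lowest eigenvalue by Picone's identity, and
the Wronskian of two positive eigenfunctions shows that a larger potential has a larger lowest
eigenvalue. A positive eigenfunction exists for all small `t`, because the eigenvalue problem is
locally solvable near the constant function `1`, by surjectivity of its linearization there.
-/

noncomputable section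

open Filter Topology
open scoped BoundedContinuousFunction

theorem eventually_exists_perturbed_eigenvector {𝕜 X Y : Type*} [NontriviallyNormedField 𝕜]
    [CompleteSpace 𝕜] [NormedAddCommGroup X] [NormedSpace 𝕜 X] [CompleteSpace X]
    [NormedAddCommGroup Y] [NormedSpace 𝕜 Y] [CompleteSpace Y] (A J B : X →L[𝕜] Y) {e : X}
    (hAe : A e = 0) (hsurj : Function.Surjective fun p : X × 𝕜 => A p.1 - p.2 • J e)
    {U : Set X} (hU : U ∈ 𝓝 e) :
    ∀ᶠ t in 𝓝 (0 : 𝕜), ∃ μ : 𝕜, ∃ x ∈ U, A x + t • B x = μ • J x := by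
  let F : X × 𝕜 × 𝕜 → Y × 𝕜 := fun p => (A p.1 + p.2.2 • B p.1 - p.2.1 • J p.1, p.2.2)
  obtain ⟨F', hF', hF'_apply⟩ : ∃ F' : X × 𝕜 × 𝕜 →L[𝕜] Y × 𝕜,
      HasStrictFDerivAt F F' (e, 0, 0) ∧
        ∀ p, F' p = (A p.1 + p.2.2 • B e - p.2.1 • J e, p.2.2) := by
    have hx := hasStrictFDerivAt_fst (𝕜 := 𝕜) (p := (e, ((0 : 𝕜), (0 : 𝕜))))
    have hμt := hasStrictFDerivAt_snd (𝕜 := 𝕜) (p := (e, ((0 : 𝕜), (0 : 𝕜))))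
    refine ⟨_, (((A.hasStrictFDerivAt.comp _ hx).add
      (hμt.snd.smul (B.hasStrictFDerivAt.comp _ hx))).sub
      (hμt.fst.smul (J.hasStrictFDerivAt.comp _ hx))).prodMk hμt.snd, fun p => ?_⟩
    simp
  have hF'_surj : F'.range = ⊤ := by
    refine LinearMap.range_eq_top.mpr fun ⟨y, t⟩ => ?_
    obtain ⟨⟨x, μ⟩, hxμ⟩ := hsurj (y - t • B e)
    refine ⟨(x, μ, t), (hF'_apply _).trans (Prod.ext ?_ rfl)⟩
    exact (add_sub_right_comm _ _ _).trans (eq_sub_iff_add_eq.mp hxμ)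
  have hF0 : F (e, 0, 0) = (0, 0) := by simp [F, hAe]
  have himage : F '' {p | p.1 ∈ U} ∈ 𝓝 ((0 : Y), (0 : 𝕜)) := by
    rw [← hF0, ← hF'.map_nhds_eq_of_surj hF'_surj]
    exact image_mem_map (continuous_fst.continuousAt.preimage_mem_nhds hU)
  have hline : Tendsto (fun t : 𝕜 => ((0 : Y), t)) (𝓝 0) (𝓝 (0, 0)) :=
    (Continuous.prodMk_right (0 : Y)).tendsto 0
  filter_upwards [hline himage] with t ht
  obtain ⟨⟨x, μ, t'⟩, hxU, hx⟩ := ht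
  obtain ⟨h, rfl⟩ : A x + t' • B x - μ • J x = 0 ∧ t' = t := by simpa [F] using hx
  exact ⟨μ, x, hxU, sub_eq_zero.mp h⟩

theorem monotoneOn_Icc_of_hasDerivWithinAt_nonneg {g g' : ℝ → ℝ} {a b : ℝ}
    (hg : ∀ s ∈ Icc a b, HasDerivWithinAt g (g' s) (Icc a b) s)
    (hg' : ∀ s ∈ Icc a b, 0 ≤ g' s) : MonotoneOn g (Icc a b) :=
  monotoneOn_of_hasDerivWithinAt_nonneg (convex_Icc a b)
    (fun s hs => (hg s hs).continuousWithinAt)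
    (fun s hs => (hg s (interior_subset hs)).mono interior_subset)
    fun s hs => hg' s (interior_subset hs)

theorem eq_zero_of_hasDerivWithinAt_nonneg_of_le {g g' : ℝ → ℝ} {a b : ℝ} (hab : a < b)
    (hg : ∀ s ∈ Icc a b, HasDerivWithinAt g (g' s) (Icc a b) s)
    (hg' : ∀ s ∈ Icc a b, 0 ≤ g' s) (hba : g b ≤ g a) : ∀ s ∈ Icc a b, g' s = 0 := by
  have hmono := monotoneOn_Icc_of_hasDerivWithinAt_nonneg hg hg'
  have hconst : ∀ s ∈ Icc a b, g s = g a := fun s hs =>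
    le_antisymm ((hmono hs (right_mem_Icc.mpr hab.le) hs.2).trans hba)
      (hmono (left_mem_Icc.mpr hab.le) hs hs.1)
  intro s hs
  exact (uniqueDiffOn_Icc hab s hs).eq_deriv _ (hg s hs)
    ((hasDerivWithinAt_const s _ (g a)).congr hconst (hconst s hs))

theorem eq_zero_of_hasDerivWithinAt_nonneg_of_sum_le {ι : Type*} [Fintype ι] {a b : ι → ℝ}
    (hab : ∀ i, a i < b i) {g g' : ι → ℝ → ℝ}
    (hg : ∀ i, ∀ s ∈ Icc (a i) (b i), HasDerivWithinAt (g i) (g' i s) (Icc (a i) (b i)) s)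
    (hg' : ∀ i, ∀ s ∈ Icc (a i) (b i), 0 ≤ g' i s)
    (hsum : ∑ i, (g i (b i) - g i (a i)) ≤ 0) :
    ∀ i, ∀ s ∈ Icc (a i) (b i), g' i s = 0 := by
  have hle : ∀ i ∈ Finset.univ, 0 ≤ g i (b i) - g i (a i) := fun i _ =>
    sub_nonneg.mpr (monotoneOn_Icc_of_hasDerivWithinAt_nonneg (hg i) (hg' i)
      (left_mem_Icc.mpr (hab i).le) (right_mem_Icc.mpr (hab i).le) (hab i).le)
  have hzero := (Finset.sum_eq_zero_iff_of_nonneg hle).mp (hsum.antisymm (Finset.sum_nonneg hle))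
  exact fun i => eq_zero_of_hasDerivWithinAt_nonneg_of_le (hab i) (hg i) (hg' i)
    (sub_eq_zero.mp (hzero i (Finset.mem_univ i))).le

theorem min_le_of_injOn_sublevel {g : ℝ → ℝ} {a b c x : ℝ} (hg : ContinuousOn g (Icc a b))
    (hinj : InjOn g {s ∈ Icc a b | g s < c}) (hx : x ∈ Icc a b) :
    min c (min (g a) (g b)) ≤ g x := by
  by_contra! hlt
  obtain ⟨y, hgy, hy⟩ := exists_between hlt
  obtain ⟨hyc, hya, hyb⟩ : y < c ∧ y < g a ∧ y < g b := by simpa only [lt_min_iff] using hy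
  obtain ⟨s, hs, rfl⟩ := intermediate_value_Icc' hx.1 (hg.mono (Icc_subset_Icc_right hx.2))
    ⟨hgy.le, hya.le⟩
  obtain ⟨s', hs', hss'⟩ := intermediate_value_Icc hx.2 (hg.mono (Icc_subset_Icc_left hx.1))
    ⟨hgy.le, hyb.le⟩
  obtain rfl : s' = s := hinj ⟨⟨hx.1.trans hs'.1, hs'.2⟩, hss'.trans_lt hyc⟩
    ⟨⟨hs.1, hs.2.trans hx.2⟩, hyc⟩ hss'
  exact hgy.ne (congrArg g (hs.2.antisymm hs'.1)).symm

theorem norm_intervalIntegral_projIcc_le {a b : ℝ} (h : a ≤ b) (f : ℝ →ᵇ ℝ) (s : ℝ) :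
    ‖∫ r in a..projIcc a b h s, f r‖ ≤ (b - a) * ‖f‖ := by
  have hs := (projIcc a b h s).2
  calc ‖∫ r in a..projIcc a b h s, f r‖ ≤ ‖f‖ * |projIcc a b h s - a| :=
        intervalIntegral.norm_integral_le_of_norm_le_const fun r _ => f.norm_coe_le_norm r
    _ ≤ (b - a) * ‖f‖ := by
        rw [abs_of_nonneg (sub_nonneg.mpr hs.1), mul_comm]
        gcongr
        exact hs.2

/-- The primitive of `f` on `[a, b]` vanishing at `a`, extended by constants so that it is again
bounded on `ℝ`. -/
def primitive {a b : ℝ} (h : a ≤ b) : (ℝ →ᵇ ℝ) →L[ℝ] (ℝ →ᵇ ℝ) :=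
  LinearMap.mkContinuous
    { toFun := fun f => BoundedContinuousFunction.ofNormedAddCommGroup
        (fun s => ∫ r in a..projIcc a b h s, f r)
        ((intervalIntegral.continuous_primitive (fun _ _ => f.continuous.intervalIntegrable _ _)
          a).comp (continuous_subtype_val.comp continuous_projIcc))
        ((b - a) * ‖f‖) (norm_intervalIntegral_projIcc_le h f)
      map_add' := fun f g => by
        ext s
        exact intervalIntegral.integral_add (f.continuous.intervalIntegrable _ _)
          (g.continuous.intervalIntegrable _ _)
      map_smul' := fun c f => by
        ext s
        exact intervalIntegral.integral_const_mul c _ }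
    (b - a) fun f => (BoundedContinuousFunction.norm_le
      (mul_nonneg (sub_nonneg.mpr h) (norm_nonneg f))).mpr (norm_intervalIntegral_projIcc_le h f)

section primitive

variable {a b : ℝ} {h : a ≤ b}

theorem primitive_apply {f : ℝ →ᵇ ℝ} {s : ℝ} (hs : s ∈ Icc a b) :
    primitive h f s = ∫ r in a..s, f r := by
  change ∫ r in a..projIcc a b h s, f r = _
  rw [projIcc_of_mem h hs]

theorem primitive_left (f : ℝ →ᵇ ℝ) : primitive h f a = 0 := by
  rw [primitive_apply (left_mem_Icc.mpr h), intervalIntegral.integral_same]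

theorem primitive_one {s : ℝ} (hs : s ∈ Icc a b) : primitive h 1 s = s - a := by
  simp [primitive_apply hs]

theorem hasDerivWithinAt_primitive (f : ℝ →ᵇ ℝ) {s : ℝ} (hs : s ∈ Icc a b) :
    HasDerivWithinAt (primitive h f) (f s) (Icc a b) s :=
  ((intervalIntegral.integral_hasDerivAt_right (f.continuous.intervalIntegrable _ _)
    (f.continuous.stronglyMeasurableAtFilter _ _) f.continuous.continuousAt).hasDerivWithinAt).congr
    (fun _ hr => primitive_apply hr) (primitive_apply hs)

end primitive

theorem exists_boundedContinuousFunction_eqOn_Icc {f : ℝ → ℝ} {a b : ℝ} (h : a ≤ b)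
    (hf : ContinuousOn f (Icc a b)) : ∃ g : ℝ →ᵇ ℝ, EqOn g f (Icc a b) := by
  refine ⟨(BoundedContinuousFunction.mkOfCompact ⟨_, hf.domRestrict⟩).compContinuous
    ⟨projIcc a b h, continuous_projIcc⟩, fun s hs => ?_⟩
  change f (projIcc a b h s) = f s
  rw [projIcc_of_mem h hs]

/-- Adding to `Λ` the operator `b ↦ ∑ i, b i`, with constant values, makes it invertible. -/
theorem exists_eq_of_sum_eq_zero {ι 𝕜 : Type*} [Fintype ι] [Nonempty ι] [Field 𝕜] [CharZero 𝕜]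
    (Λ : (ι → 𝕜) →ₗ[𝕜] (ι → 𝕜)) (h_sum : ∀ b, ∑ i, Λ b i = 0)
    (h_ker : ∀ b, Λ b = 0 → ∀ i j, b i = b j) {r : ι → 𝕜} (hr : ∑ i, r i = 0) :
    ∃ b, Λ b = r := by
  let S : (ι → 𝕜) →ₗ[𝕜] 𝕜 := ∑ i, LinearMap.proj i
  have hS : ∀ b, S b = ∑ i, b i := fun b => by simp [S]
  let Λ' : (ι → 𝕜) →ₗ[𝕜] (ι → 𝕜) := Λ + S.smulRight 1
  have hΛ' : ∀ b i, Λ' b i = Λ b i + S b := fun b i => by simp [Λ']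
  have h_mean : ∀ b, ∑ i, Λ' b i = 0 → S b = 0 := fun b hb => by
    simpa [hΛ', Finset.sum_add_distrib, h_sum] using hb
  have h_inj : Function.Injective Λ' := by
    refine (injective_iff_map_eq_zero Λ').mpr fun b hb => ?_
    have hSb : S b = 0 := h_mean b (by simp [hb])
    have h_const := h_ker b (funext fun i => by simpa [hΛ', hSb] using congrFun hb i)
    funext i
    rw [hS, Finset.sum_congr rfl fun j _ => h_const j i] at hSb
    simpa using hSb
  obtain ⟨b, rfl⟩ := LinearMap.injective_iff_surjective.mp h_inj r
  exact ⟨b, funext fun i => by simp [hΛ', h_mean b hr]⟩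

theorem eq_of_adj_of_dist_lt {V : Type*} {T : SimpleGraph V} (hT : T.IsTree) {a w y z : V}
    (hy : T.Adj w y) (hz : T.Adj w z) (hay : T.dist a y < T.dist a w)
    (haz : T.dist a z < T.dist a w) : y = z := by
  have exists_path : ∀ y, T.Adj w y → T.dist a y < T.dist a w →
      ∃ p : T.Walk a w, p.IsPath ∧ p.penultimate = y := by
    intro y hy hlt
    obtain ⟨p, hp, h_length⟩ := hT.connected.exists_path_of_dist a y
    have hwp : w ∉ p.support := by
      classical
      intro h
      have h_dist := SimpleGraph.dist_le (p.takeUntil w h)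
      have h_take := p.length_takeUntil_le_length h
      omega
    exact ⟨p.concat hy.symm, hp.concat hwp hy.symm, by simp⟩
  obtain ⟨p, hp, rfl⟩ := exists_path y hy hay
  obtain ⟨p', hp', rfl⟩ := exists_path z hz haz
  rw [(hT.existsUnique_path a w).unique hp hp']

namespace MetricGraph

variable {V E : Type*} {G : MetricGraph V E}

/-! ### Functions on the points of a metric graph -/

theorem pt_zero (e : E) : G.pt e 0 = .vertex (G.src e) := by simp [pt]

theorem pt_len (e : E) : G.pt e (G.len e) = .vertex (G.tgt e) := by
  simp [pt, not_le.mpr (G.len_pos e)]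

theorem pt_coe (e : E) (s : Ioo (0 : ℝ) (G.len e)) : G.pt e s = .interior e s := by
  simp [pt, not_le.mpr s.2.1, not_le.mpr s.2.2]

theorem zero_mem_Icc_len (e : E) : (0 : ℝ) ∈ Icc 0 (G.len e) :=
  left_mem_Icc.mpr (G.len_pos e).le

theorem len_mem_Icc_len (e : E) : G.len e ∈ Icc 0 (G.len e) :=
  right_mem_Icc.mpr (G.len_pos e).le

theorem exists_pt_eq (x : G.Point) : ∃ e, ∃ s ∈ Icc 0 (G.len e), G.pt e s = x := by
  cases x with
  | vertex v =>
    obtain ⟨e, rfl | rfl⟩ := G.exists_incident v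
    · exact ⟨e, 0, zero_mem_Icc_len e, pt_zero e⟩
    · exact ⟨e, G.len e, len_mem_Icc_len e, pt_len e⟩
  | interior e s => exact ⟨e, s, Ioo_subset_Icc_self s.2, pt_coe e s⟩

theorem finite_vertices [Finite E] (G : MetricGraph V E) : Finite V := by
  refine Finite.of_surjective (Sum.elim G.src G.tgt) fun v => ?_
  obtain ⟨e, h | h⟩ := G.exists_incident v
  · exact ⟨.inl e, h⟩
  · exact ⟨.inr e, h⟩

theorem edist_pt_le {e : E} {s t : ℝ} (hs : s ∈ Icc 0 (G.len e)) (ht : t ∈ Icc 0 (G.len e)) :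
    edist (G.pt e s) (G.pt e t) ≤ ENNReal.ofReal |s - t| :=
  iInf₂_le |s - t| (by simpa using Chain.cons e s t hs ht _ 0 (Chain.nil (G.pt e t)))

theorem continuousOn_pt (e : E) : ContinuousOn (G.pt e) (Icc 0 (G.len e)) := by
  have hlip : LipschitzOnWith 1 (G.pt e) (Icc 0 (G.len e)) := fun s hs t ht => by
    rw [ENNReal.coe_one, one_mul, edist_dist, Real.dist_eq]
    exact edist_pt_le hs ht
  exact hlip.continuousOn

theorem Chain.edist_le {α : Type*} [PseudoEMetricSpace α] {K : NNReal} {f : G.Point → α}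
    (hf : ∀ e, LipschitzOnWith K (fun s => f (G.pt e s)) (Icc 0 (G.len e))) {x y : G.Point} {r : ℝ}
    (hr : G.Chain x y r) : edist (f x) (f y) ≤ K * ENNReal.ofReal r := by
  induction hr with
  | nil x => simp
  | cons e s t hs ht y r hr ih =>
    rw [ENNReal.ofReal_add (abs_nonneg _) hr.nonneg, mul_add, ← Real.dist_eq, ← edist_dist]
    exact (edist_triangle _ _ _).trans (add_le_add (hf e hs ht) ih)

theorem lipschitzWith_of_lipschitzOnWith_edges {α : Type*} [PseudoEMetricSpace α] {K : NNReal}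
    (hK : K ≠ 0) {f : G.Point → α}
    (hf : ∀ e, LipschitzOnWith K (fun s => f (G.pt e s)) (Icc 0 (G.len e))) :
    LipschitzWith K f := fun x y => by
  change _ ≤ K * ⨅ (r : ℝ) (_ : G.Chain x y r), ENNReal.ofReal r
  have hK' : (K : ℝ≥0∞) ≠ 0 := ENNReal.coe_ne_zero.mpr hK
  simp only [ENNReal.mul_iInf_of_ne hK' ENNReal.coe_ne_top]
  exact le_iInf₂ fun r hr => hr.edist_le hf

theorem continuous_of_lipschitzOnWith_edges [Finite E] {α : Type*} [PseudoEMetricSpace α]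
    {f : G.Point → α}
    (hf : ∀ e, ∃ K, LipschitzOnWith K (fun s => f (G.pt e s)) (Icc 0 (G.len e))) :
    Continuous f := by
  cases nonempty_fintype E
  choose K hK using hf
  have hlip : LipschitzWith (∑ e, K e + 1) f :=
    lipschitzWith_of_lipschitzOnWith_edges (by positivity) fun e => (hK e).weaken
      ((Finset.single_le_sum (fun _ _ => zero_le) (Finset.mem_univ e)).trans le_self_add)
  exact hlip.continuous

/-- The function with values `b` at the vertices and `F e` in the interior of the edge `e`. -/
def glue (b : V → ℝ) (F : E → ℝ → ℝ) : G.Point → ℝ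
  | .vertex v => b v
  | .interior e s => F e s

theorem glue_pt {b : V → ℝ} {F : E → ℝ → ℝ} {e : E} (h_src : F e 0 = b (G.src e))
    (h_tgt : F e (G.len e) = b (G.tgt e)) {s : ℝ} (hs : s ∈ Icc 0 (G.len e)) :
    glue b F (G.pt e s) = F e s := by
  rcases hs.1.eq_or_lt with rfl | h_pos
  · rw [pt_zero, h_src, glue]
  rcases hs.2.eq_or_lt with rfl | h_lt
  · rw [pt_len, h_tgt, glue]
  · exact congrArg (glue b F) (pt_coe e ⟨s, h_pos, h_lt⟩)

/-! ### Pendant edges -/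

/-- The unordered pair of the ends of the edge `e`. -/
def ends (G : MetricGraph V E) (e : E) : Sym2 V := s(G.src e, G.tgt e)

/-- `G.IsPendant w f`: the edge `f` is not a loop and is the only edge at its end `w`. -/
structure IsPendant (G : MetricGraph V E) (w : V) (f : E) : Prop where
  src_ne_tgt : G.src f ≠ G.tgt f
  incident_iff : ∀ e, w ∈ G.ends e ↔ e = f

open Classical in
/-- The coordinate on the edge `f` measured from its end `w`. It is an involution on
`[0, len f]`, hence also converts this coordinate back into the one of `G.pt f`. -/
def coordFrom (G : MetricGraph V E) (w : V) (f : E) (s : ℝ) : ℝ :=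
  if G.src f = w then s else G.len f - s

open Classical in
/-- The distance to the end `w` of the pendant edge `f`, truncated at the length of `f`. -/
def pendantDist (G : MetricGraph V E) (w : V) (f : E) : G.Point → ℝ :=
  glue (fun v => if v = w then 0 else G.len f)
    fun e s => if e = f then G.coordFrom w f s else G.len f

/-- The tent potential of a pendant edge `f`: it falls linearly along `f` from `1` at the end `w`
to `0` at the other end, and vanishes on all other edges. -/
def pendantTent (G : MetricGraph V E) (w : V) (f : E) (x : G.Point) : ℝ :=
  1 - G.pendantDist w f x / G.len f

section pendant

variable {w : V} {f : E}

theorem coordFrom_coordFrom (s : ℝ) : G.coordFrom w f (G.coordFrom w f s) = s := by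
  unfold coordFrom
  split_ifs <;> ring

theorem coordFrom_mem_Icc {s : ℝ} (hs : s ∈ Icc 0 (G.len f)) :
    G.coordFrom w f s ∈ Icc 0 (G.len f) := by
  unfold coordFrom
  split_ifs
  exacts [hs, ⟨sub_nonneg.mpr hs.2, sub_le_self _ hs.1⟩]

theorem abs_coordFrom_sub (s t : ℝ) : |G.coordFrom w f s - G.coordFrom w f t| = |s - t| := by
  unfold coordFrom
  split_ifs
  · rfl
  · rw [sub_sub_sub_cancel_left, abs_sub_comm]

theorem pendantDist_vertex_self : G.pendantDist w f (.vertex w) = 0 := if_pos rfl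

theorem pendantDist_vertex_of_ne {v : V} (hv : v ≠ w) :
    G.pendantDist w f (.vertex v) = G.len f := if_neg hv

theorem pendantTent_vertex_self : G.pendantTent w f (.vertex w) = 1 := by
  rw [pendantTent, pendantDist_vertex_self, zero_div, sub_zero]

namespace IsPendant

variable (hw : G.IsPendant w f)
include hw

theorem pt_coordFrom_zero : G.pt f (G.coordFrom w f 0) = .vertex w := by
  unfold coordFrom
  split_ifs with h
  · rw [pt_zero, h]
  · rw [sub_zero, pt_len, (Sym2.mem_iff.mp ((hw.incident_iff f).mpr rfl)).resolve_left (Ne.symm h)]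

theorem pendantDist_pt {s : ℝ} (hs : s ∈ Icc 0 (G.len f)) :
    G.pendantDist w f (G.pt f s) = G.coordFrom w f s := by
  have h_ne := hw.src_ne_tgt
  have h_end := Sym2.mem_iff.mp ((hw.incident_iff f).mpr rfl)
  unfold pendantDist
  rw [glue_pt _ _ hs, if_pos rfl] <;> unfold coordFrom <;> grind

theorem pendantDist_pt_of_ne {e : E} (he : e ≠ f) {s : ℝ} (hs : s ∈ Icc 0 (G.len e)) :
    G.pendantDist w f (G.pt e s) = G.len f := by
  have h_end := mt Sym2.mem_iff.mpr (mt (hw.incident_iff e).mp he)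
  unfold pendantDist
  rw [glue_pt _ _ hs, if_neg he] <;> grind

theorem pendantDist_mem_Icc (x : G.Point) : G.pendantDist w f x ∈ Icc 0 (G.len f) := by
  obtain ⟨e, s, hs, rfl⟩ := exists_pt_eq x
  by_cases he : e = f
  · subst he
    rw [hw.pendantDist_pt hs]
    exact coordFrom_mem_Icc hs
  · rw [hw.pendantDist_pt_of_ne he hs]
    exact len_mem_Icc_len f

theorem lipschitzWith_pendantDist : LipschitzWith 1 (G.pendantDist w f) :=
  lipschitzWith_of_lipschitzOnWith_edges one_ne_zero fun e s hs t ht => by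
    by_cases he : e = f
    · subst he
      simp only [hw.pendantDist_pt hs, hw.pendantDist_pt ht, edist_dist, Real.dist_eq,
        abs_coordFrom_sub, ENNReal.coe_one, one_mul, le_refl]
    · simp [hw.pendantDist_pt_of_ne he hs, hw.pendantDist_pt_of_ne he ht]

theorem eq_pt_of_pendantDist_lt {x : G.Point} (hx : G.pendantDist w f x < G.len f) :
    x = G.pt f (G.coordFrom w f (G.pendantDist w f x)) := by
  obtain ⟨e, s, hs, rfl⟩ := exists_pt_eq x
  obtain rfl : e = f := by
    by_contra he
    exact hx.ne (hw.pendantDist_pt_of_ne he hs)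
  rw [hw.pendantDist_pt hs, coordFrom_coordFrom]

theorem injOn_pendantDist : InjOn (G.pendantDist w f) {x | G.pendantDist w f x < G.len f} :=
  fun x hx y hy hxy => by
    rw [hw.eq_pt_of_pendantDist_lt hx, hw.eq_pt_of_pendantDist_lt hy, hxy]

theorem ofReal_pendantDist (x : G.Point) : ENNReal.ofReal (G.pendantDist w f x) =
    min (ENNReal.ofReal (G.len f)) (edist x (.vertex w)) := by
  have hx := hw.pendantDist_mem_Icc x
  refine le_antisymm (le_min (ENNReal.ofReal_le_ofReal hx.2) ?_) (min_le_iff.mpr ?_)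
  · simpa [pendantDist_vertex_self, edist_dist, abs_of_nonneg hx.1] using
      hw.lipschitzWith_pendantDist x (.vertex w)
  · rcases hx.2.eq_or_lt with h_eq | h_lt
    · exact .inl (ENNReal.ofReal_le_ofReal h_eq.ge)
    · right
      have h_edist := edist_pt_le (coordFrom_mem_Icc (w := w) hx)
        (coordFrom_mem_Icc (w := w) (zero_mem_Icc_len f))
      rwa [← hw.eq_pt_of_pendantDist_lt h_lt, hw.pt_coordFrom_zero, abs_coordFrom_sub, sub_zero,
        abs_of_nonneg hx.1] at h_edist

theorem min_pendantDist_le_of_path {γ : ℝ → G.Point} {a b : ℝ} (hγ : ContinuousOn γ (Icc a b))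
    (hinj : InjOn γ (Icc a b)) {s : ℝ} (hs : s ∈ Icc a b) :
    min (G.len f) (min (G.pendantDist w f (γ a)) (G.pendantDist w f (γ b))) ≤
      G.pendantDist w f (γ s) :=
  min_le_of_injOn_sublevel (hw.lipschitzWith_pendantDist.continuous.comp_continuousOn hγ)
    (fun _ hr _ hr' h => hinj hr.1 hr'.1 (hw.injOn_pendantDist hr.2 hr'.2 h)) hs

theorem pendantDist_comp_isometry {L s s₀ : ℝ} {c : ℝ → G.Point}
    (hc : Isometry ((Icc 0 L).domRestrict c)) (hs₀ : s₀ ∈ Icc 0 L) (hcs₀ : c s₀ = .vertex w)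
    (hs : s ∈ Icc 0 L) : G.pendantDist w f (c s) = min (G.len f) |s - s₀| := by
  have h_edist : edist (c s) (.vertex w) = ENNReal.ofReal |s - s₀| := by
    rw [← hcs₀, ← Real.dist_eq, ← edist_dist]
    exact hc ⟨s, hs⟩ ⟨s₀, hs₀⟩
  have h := hw.ofReal_pendantDist (c s)
  rwa [h_edist, ← ENNReal.ofReal_min, ENNReal.ofReal_eq_ofReal_iff
    (hw.pendantDist_mem_Icc _).1 (le_min (G.len_pos f).le (abs_nonneg _))] at h

theorem eq_vertex_of_pendantDist_eq_zero {x : G.Point} (hx : G.pendantDist w f x = 0) :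
    x = .vertex w :=
  hw.injOn_pendantDist (hx.trans_lt (G.len_pos f))
    (pendantDist_vertex_self.trans_lt (G.len_pos f)) (hx.trans pendantDist_vertex_self.symm)

theorem isometry_endpoint_eq_vertex {L s₀ : ℝ} {c : ℝ → G.Point}
    (hc : Isometry ((Icc 0 L).domRestrict c)) (hs₀ : s₀ ∈ Icc 0 L) (hcs₀ : c s₀ = .vertex w) :
    c 0 = .vertex w ∨ c L = .vertex w := by
  have h_min := hw.min_pendantDist_le_of_path
    (continuousOn_iff_continuous_domRestrict.mpr hc.continuous)
    (injOn_iff_injective.mpr hc.injective) hs₀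
  rw [hcs₀, pendantDist_vertex_self, min_le_iff, or_iff_right (G.len_pos f).not_ge,
    min_le_iff] at h_min
  exact h_min.imp
    (fun h => hw.eq_vertex_of_pendantDist_eq_zero (h.antisymm (hw.pendantDist_mem_Icc _).1))
    (fun h => hw.eq_vertex_of_pendantDist_eq_zero (h.antisymm (hw.pendantDist_mem_Icc _).1))

theorem concaveOn_pendantDist_comp_of_eq_vertex {L s₀ : ℝ} {c : ℝ → G.Point}
    (hc : Isometry ((Icc 0 L).domRestrict c)) (hs₀ : s₀ ∈ Icc 0 L) (hcs₀ : c s₀ = .vertex w) :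
    ConcaveOn ℝ (Icc 0 L) (G.pendantDist w f ∘ c) := by
  have h_conv : Convex ℝ (Icc 0 L) := convex_Icc 0 L
  have h0L := hs₀.1.trans hs₀.2
  rcases hw.isometry_endpoint_eq_vertex hc hs₀ hcs₀ with h | h
  · have h_conc : ConcaveOn ℝ (Icc 0 L) fun s => min (G.len f) s :=
      (concaveOn_const _ h_conv).inf (concaveOn_id h_conv)
    refine h_conc.congr fun s hs => ?_
    have h_dist := hw.pendantDist_comp_isometry hc (left_mem_Icc.mpr h0L) h hs
    rw [sub_zero, abs_of_nonneg hs.1] at h_dist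
    exact h_dist.symm
  · have h_conc : ConcaveOn ℝ (Icc 0 L) fun s => min (G.len f) (L - s) :=
      (concaveOn_const _ h_conv).inf ((concaveOn_const L h_conv).sub (convexOn_id h_conv))
    refine h_conc.congr fun s hs => ?_
    have h_dist := hw.pendantDist_comp_isometry hc (right_mem_Icc.mpr h0L) h hs
    rw [abs_sub_comm, abs_of_nonneg (sub_nonneg.mpr hs.2)] at h_dist
    exact h_dist.symm

theorem pendantDist_eq_of_path {v v' : V} {P : Set G.Point}
    (hP : G.IsPath (.vertex v) (.vertex v') P) (hwP : Point.vertex w ∉ P) {x : G.Point}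
    (hx : x ∈ P) : G.pendantDist w f x = G.len f := by
  obtain ⟨γ, hγ, hinj, h0, h1, rfl⟩ := hP
  obtain ⟨r, hr, rfl⟩ := hx
  have h_vertex : ∀ {r v}, r ∈ Icc (0 : ℝ) 1 → γ r = .vertex v →
      G.pendantDist w f (.vertex v) = G.len f := fun hr hv =>
    pendantDist_vertex_of_ne fun h => hwP ⟨_, hr, h ▸ hv⟩
  have h_min := hw.min_pendantDist_le_of_path hγ hinj hr
  rw [h0, h1, h_vertex (left_mem_Icc.mpr zero_le_one) h0,
    h_vertex (right_mem_Icc.mpr zero_le_one) h1, min_self, min_self] at h_min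
  exact (hw.pendantDist_mem_Icc _).2.antisymm h_min

theorem concaveOn_pendantDist_comp {v v' : V} {P : Set G.Point}
    (hP : G.IsPath (.vertex v) (.vertex v') P) {L : ℝ} {c : ℝ → G.Point}
    (hc : Isometry ((Icc 0 L).domRestrict c)) (hcP : c '' Icc 0 L = P) :
    ConcaveOn ℝ (Icc 0 L) (G.pendantDist w f ∘ c) := by
  by_cases hwP : Point.vertex w ∈ P
  · obtain ⟨s₀, hs₀, hcs₀⟩ := hcP ▸ hwP
    exact hw.concaveOn_pendantDist_comp_of_eq_vertex hc hs₀ hcs₀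
  · exact (concaveOn_const (G.len f) (convex_Icc 0 L)).congr fun s hs =>
      (hw.pendantDist_eq_of_path hP hwP (hcP ▸ mem_image_of_mem c hs)).symm

theorem continuous_pendantTent : Continuous (G.pendantTent w f) :=
  continuous_const.sub (hw.lipschitzWith_pendantDist.continuous.div_const _)

theorem pendantTent_pt_of_ne {e : E} (he : e ≠ f) {s : ℝ} (hs : s ∈ Icc 0 (G.len e)) :
    G.pendantTent w f (G.pt e s) = 0 := by
  rw [pendantTent, hw.pendantDist_pt_of_ne he hs, div_self (G.len_pos f).ne', sub_self]

theorem pendantTent_mem_Icc (x : G.Point) : G.pendantTent w f x ∈ Icc 0 1 := by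
  have hx := hw.pendantDist_mem_Icc x
  exact ⟨sub_nonneg.mpr (div_le_one_of_le₀ hx.2 (G.len_pos f).le),
    sub_le_self _ (div_nonneg hx.1 (G.len_pos f).le)⟩

theorem smul_pendantTent_mem_convexClass [Fintype E] {t M : ℝ} (ht : 0 ≤ t) (htM : t ≤ M) :
    t • G.pendantTent w f ∈ G.convexClass M := by
  intro v v' _ _ _ P hP
  refine ⟨fun L c hc hcP => ?_, fun x _ => ?_⟩
  · exact ((convexOn_const 1 (convex_Icc 0 L)).sub ((hw.concaveOn_pendantDist_comp hP hc hcP).smul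
      (inv_nonneg.mpr (G.len_pos f).le))).smul ht |>.congr fun s _ => by
        simp [pendantTent, div_eq_inv_mul]
  · have hx := hw.pendantTent_mem_Icc x
    exact ⟨mul_nonneg ht hx.1, (mul_le_of_le_one_right ht hx.2).trans htM⟩

end IsPendant

end pendant

/-! ### Sides of an edge of a tree -/

theorem eq_of_forall_src_eq_tgt (hG : G.toSimpleGraph.Connected) {α : Type*} {b : V → α}
    (hb : ∀ e, b (G.src e) = b (G.tgt e)) (v w : V) : b v = b w := by
  have h_adj : ∀ v w, G.toSimpleGraph.Adj v w → b v = b w := by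
    intro v w h
    rw [toSimpleGraph, SimpleGraph.fromRel_adj] at h
    obtain ⟨-, ⟨e, rfl, rfl⟩ | ⟨e, rfl, rfl⟩⟩ := h
    exacts [hb e, (hb e).symm]
  obtain ⟨p⟩ := hG.preconnected v w
  induction p with
  | nil => rfl
  | cons h _ ih => exact (h_adj _ _ h).trans ih

/-- The vertices that can be reached from `b` without using the edge `f`. -/
def side (G : MetricGraph V E) (f : E) (b : V) : Set V :=
  {v | (G.toSimpleGraph.deleteEdges {G.ends f}).Reachable b v}

theorem self_mem_side (f : E) (b : V) : b ∈ G.side f b := SimpleGraph.Reachable.refl b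

namespace IsTree

variable {e f : E} {a b v w : V} (hG : G.IsTree)
include hG

theorem adj_of_ends_eq (he : G.ends e = s(v, w)) : G.toSimpleGraph.Adj v w := by
  rw [toSimpleGraph, SimpleGraph.fromRel_adj]
  rcases Sym2.eq_iff.mp he with ⟨rfl, rfl⟩ | ⟨rfl, rfl⟩
  exacts [⟨hG.1 e, .inl ⟨e, rfl, rfl⟩⟩, ⟨(hG.1 e).symm, .inr ⟨e, rfl, rfl⟩⟩]

theorem mem_side_iff (he : G.ends e = s(v, w)) (hef : e ≠ f) :
    v ∈ G.side f b ↔ w ∈ G.side f b := by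
  have h_adj : (G.toSimpleGraph.deleteEdges {G.ends f}).Adj v w :=
    SimpleGraph.deleteEdges_adj.mpr
      ⟨hG.adj_of_ends_eq he, fun h => hef (hG.2.1 e f (he.trans h))⟩
  exact ⟨fun h => h.trans h_adj.reachable, fun h => h.trans h_adj.symm.reachable⟩

theorem disjoint_side (hf : G.ends f = s(a, b)) : Disjoint (G.side f a) (G.side f b) := by
  have h_bridge := SimpleGraph.isBridge_iff.mp
    (SimpleGraph.isAcyclic_iff_forall_adj_isBridge.mp hG.2.2.isAcyclic (hG.adj_of_ends_eq hf))
  exact Set.disjoint_left.mpr fun v ha hb => h_bridge (hf ▸ ha.trans hb.symm)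

theorem dist_lt_of_forall_dist_le (hf : G.ends f = s(a, b)) (hw : w ∈ G.side f b)
    (hmax : ∀ v ∈ G.side f b, G.toSimpleGraph.dist a v ≤ G.toSimpleGraph.dist a w)
    (he : G.ends e = s(w, v)) : G.toSimpleGraph.dist a v < G.toSimpleGraph.dist a w := by
  have h_adj := hG.adj_of_ends_eq he
  by_cases hef : e = f
  · subst hef
    rcases Sym2.eq_iff.mp (hf.symm.trans he) with ⟨rfl, -⟩ | ⟨rfl, -⟩
    · exact absurd hw (Set.disjoint_left.mp (hG.disjoint_side hf) (self_mem_side e a))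
    · rw [SimpleGraph.dist_self]
      exact hG.2.2.connected.pos_dist_of_ne h_adj.ne.symm
  · exact (hmax v ((hG.mem_side_iff he hef).mp hw)).lt_of_ne (hG.2.2.dist_ne_of_adj a h_adj).symm

theorem exists_isPendant_mem_side [Finite E] (hf : G.ends f = s(a, b)) :
    ∃ w ∈ G.side f b, ∃ e, G.IsPendant w e := by
  have := G.finite_vertices
  obtain ⟨w, hw, hmax⟩ := Set.exists_max_image (G.side f b) (fun v => G.toSimpleGraph.dist a v)
    (Set.toFinite _) ⟨b, self_mem_side f b⟩
  obtain ⟨e, he⟩ : ∃ e, w ∈ G.ends e := by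
    obtain ⟨e, rfl | rfl⟩ := G.exists_incident w
    exacts [⟨e, Sym2.mem_mk_left _ _⟩, ⟨e, Sym2.mem_mk_right _ _⟩]
  refine ⟨w, hw, e, hG.1 e, fun e' => ⟨fun he' => hG.2.1 _ _ ?_, fun h => h ▸ he⟩⟩
  obtain ⟨y, hy⟩ := he
  obtain ⟨z, hz⟩ := he'
  have hzy : z = y := eq_of_adj_of_dist_lt hG.2.2 (hG.adj_of_ends_eq hz) (hG.adj_of_ends_eq hy)
    (hG.dist_lt_of_forall_dist_le hf hw hmax hz) (hG.dist_lt_of_forall_dist_le hf hw hmax hy)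
  exact hz.trans (hzy ▸ hy.symm)

end IsTree

/-! ### Classical solutions -/

namespace HasSobolevDeriv

variable {ℓ : ℝ} {f g : ℝ → ℝ}

theorem integrableOn (h : HasSobolevDeriv ℓ f g) : IntegrableOn g (Icc 0 ℓ) := by
  rw [integrableOn_Icc_iff_integrableOn_Ioo]
  exact h.1.integrable one_le_two

theorem intervalIntegrable (h : HasSobolevDeriv ℓ f g) {s : ℝ} (hs : s ∈ Icc 0 ℓ) :
    IntervalIntegrable g volume 0 s :=
  (intervalIntegrable_iff_integrableOn_Icc_of_le hs.1).mpr
    (h.integrableOn.mono_set (Icc_subset_Icc_right hs.2))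

theorem continuousOn (h : HasSobolevDeriv ℓ f g) : ContinuousOn f (Icc 0 ℓ) := by
  rcases le_or_gt 0 ℓ with hℓ | hℓ
  · have h_primitive := intervalIntegral.continuousOn_primitive_interval (μ := volume) (f := g)
      (a := 0) (b := ℓ) (uIcc_of_le hℓ ▸ h.integrableOn)
    rw [uIcc_of_le hℓ] at h_primitive
    exact (continuousOn_const.add h_primitive).congr h.2
  · simp [Icc_eq_empty hℓ.not_ge]

theorem congr_ae {g' : ℝ → ℝ} (h : HasSobolevDeriv ℓ f g)
    (hg : g =ᵐ[volume.restrict (Ioo 0 ℓ)] g') : HasSobolevDeriv ℓ f g' := by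
  refine ⟨h.1.ae_eq hg, fun x hx => ?_⟩
  rw [h.2 x hx]
  congr 1
  refine intervalIntegral.integral_congr_ae_restrict ?_
  rw [uIoc_of_le hx.1, restrict_Ioo_eq_restrict_Ioc] at *
  exact ae_restrict_of_ae_restrict_of_subset (Ioc_subset_Ioc_right hx.2) hg

theorem hasDerivWithinAt (h : HasSobolevDeriv ℓ f g) (hg : ContinuousOn g (Icc 0 ℓ)) {s : ℝ}
    (hs : s ∈ Icc 0 ℓ) : HasDerivWithinAt f (g s) (Icc 0 ℓ) s := by
  have := Fact.mk hs
  have h_primitive : HasDerivWithinAt (fun x => ∫ r in (0 : ℝ)..x, g r) (g s) (Icc 0 ℓ) s :=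
    intervalIntegral.integral_hasDerivWithinAt_right (h.intervalIntegrable hs)
      ⟨Icc 0 ℓ, self_mem_nhdsWithin, hg.aestronglyMeasurable measurableSet_Icc⟩ (hg s hs)
  exact (h_primitive.const_add (f 0)).congr h.2 (h.2 s hs)

theorem of_hasDerivWithinAt (hg : ContinuousOn g (Icc 0 ℓ))
    (hf : ∀ s ∈ Icc 0 ℓ, HasDerivWithinAt f (g s) (Icc 0 ℓ) s) : HasSobolevDeriv ℓ f g := by
  constructor
  · obtain ⟨C, hC⟩ := isCompact_Icc.exists_bound_of_continuousOn hg
    refine MemLp.of_bound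
      ((hg.mono Ioo_subset_Icc_self).aestronglyMeasurable measurableSet_Ioo) C ?_
    filter_upwards [ae_restrict_mem measurableSet_Ioo] with s hs
    exact hC s (Ioo_subset_Icc_self hs)
  · intro x hx
    have h_sub : Icc 0 x ⊆ Icc 0 ℓ := Icc_subset_Icc_right hx.2
    have h_ftc : ∫ r in (0 : ℝ)..x, g r = f x - f 0 :=
      intervalIntegral.integral_eq_sub_of_hasDerivAt_of_le hx.1
        (fun s hs => (hf s (h_sub hs)).continuousWithinAt.mono h_sub)
        (fun s hs => (hf s (h_sub (Ioo_subset_Icc_self hs))).hasDerivAt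
          (Icc_mem_nhds hs.1 (hs.2.trans_le hx.2)))
        ((hg.mono (by rwa [uIcc_of_le hx.1])).intervalIntegrable)
    rw [h_ftc, add_sub_cancel]

end HasSobolevDeriv

/-- `u`, with derivatives `du` along the edges, is a classical solution of `-u'' + q u = μ u` that
satisfies the Kirchhoff conditions; all derivatives are one-sided at the ends of the edges. -/
structure IsSolution [Fintype E] (G : MetricGraph V E) (q : G.Point → ℝ) (μ : ℝ)
    (u : G.Point → ℝ) (du : E → ℝ → ℝ) : Prop where
  hasDerivWithinAt : ∀ e, ∀ s ∈ Icc 0 (G.len e),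
    HasDerivWithinAt (fun s => u (G.pt e s)) (du e s) (Icc 0 (G.len e)) s
  hasDerivWithinAt_deriv : ∀ e, ∀ s ∈ Icc 0 (G.len e),
    HasDerivWithinAt (du e) ((q (G.pt e s) - μ) * u (G.pt e s)) (Icc 0 (G.len e)) s
  kirchhoff : ∀ v, G.normalDerivSum du v = 0

section solutions

variable [Fintype E] {q : G.Point → ℝ} {μ ν : ℝ} {u φ : G.Point → ℝ} {du dφ : E → ℝ → ℝ}

theorem IsSolution.continuousOn_deriv (hu : G.IsSolution q μ u du) (e : E) :
    ContinuousOn (du e) (Icc 0 (G.len e)) :=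
  fun s hs => (hu.hasDerivWithinAt_deriv e s hs).continuousWithinAt

theorem IsSolution.continuous (hu : G.IsSolution q μ u du) : Continuous u := by
  refine continuous_of_lipschitzOnWith_edges fun e => ?_
  obtain ⟨C, hC⟩ := isCompact_Icc.exists_bound_of_continuousOn (hu.continuousOn_deriv e)
  exact ⟨C.toNNReal, (convex_Icc 0 (G.len e)).lipschitzOnWith_of_nnnorm_hasDerivWithin_le
    (hu.hasDerivWithinAt e) fun s hs => NNReal.le_toNNReal_of_coe_le (hC s hs)⟩

omit [Fintype E] in
theorem continuousOn_sub_mul_comp_pt (hq : Continuous q) (hu : Continuous u) (μ : ℝ) (e : E) :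
    ContinuousOn (fun s => (q (G.pt e s) - μ) * u (G.pt e s)) (Icc 0 (G.len e)) :=
  ((hq.sub continuous_const).mul hu).comp_continuousOn (continuousOn_pt e)

theorem IsEigenfunction.exists_isSolution (hu : G.IsEigenfunction q μ u) (hq : Continuous q) :
    ∃ du, G.IsSolution q μ u du := by
  obtain ⟨-, hu_cont, du, ddu, hu_du, hdu_ddu, h_kirchhoff, h_eq⟩ := hu
  have hdu : ∀ e, HasSobolevDeriv (G.len e) (du e)
      fun s => (q (G.pt e s) - μ) * u (G.pt e s) := fun e => (hdu_ddu e).congr_ae <| by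
    filter_upwards [h_eq e] with s hs
    linear_combination -hs
  exact ⟨du, fun e s hs => (hu_du e).hasDerivWithinAt (hdu e).continuousOn hs,
    fun e s hs => (hdu e).hasDerivWithinAt (continuousOn_sub_mul_comp_pt hq hu_cont μ e) hs,
    h_kirchhoff⟩

theorem IsSolution.isEigenfunction (hu : G.IsSolution q μ u du) (hq : Continuous q)
    (hu0 : u ≠ 0) : G.IsEigenfunction q μ u :=
  ⟨hu0, hu.continuous, du, fun e s => (q (G.pt e s) - μ) * u (G.pt e s),
    fun e => .of_hasDerivWithinAt (hu.continuousOn_deriv e) (hu.hasDerivWithinAt e),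
    fun e => .of_hasDerivWithinAt (continuousOn_sub_mul_comp_pt hq hu.continuous μ e)
      (hu.hasDerivWithinAt_deriv e),
    hu.kirchhoff, fun _ => Eventually.of_forall fun _ => by ring⟩

theorem isSolution_one : G.IsSolution 0 0 1 0 where
  hasDerivWithinAt _ s _ := hasDerivWithinAt_const s _ 1
  hasDerivWithinAt_deriv _ s _ := (hasDerivWithinAt_const s _ 0).congr_deriv (by simp)
  kirchhoff v := by simp [normalDerivSum]

theorem IsSolution.congr_potential {q' : G.Point → ℝ} (hu : G.IsSolution q μ u du)
    (hq : ∀ x, q' x * u x = q x * u x) : G.IsSolution q' μ u du where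
  hasDerivWithinAt := hu.hasDerivWithinAt
  hasDerivWithinAt_deriv e s hs := (hu.hasDerivWithinAt_deriv e s hs).congr_deriv (by
    rw [sub_mul, sub_mul, hq])
  kirchhoff := hu.kirchhoff

theorem IsSolution.deriv_eq_zero_of_eq_zero (hu : G.IsSolution q μ u du) {f : E}
    (huf : ∀ s ∈ Icc 0 (G.len f), u (G.pt f s) = 0) {s : ℝ} (hs : s ∈ Icc 0 (G.len f)) :
    du f s = 0 :=
  (uniqueDiffOn_Icc (G.len_pos f) s hs).eq_deriv _ (hu.hasDerivWithinAt f s hs)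
    ((hasDerivWithinAt_const s _ 0).congr huf (huf s hs))

theorem sum_mul_normalDerivSum [Fintype V] (b : V → ℝ) (du : E → ℝ → ℝ) :
    ∑ v, b v * G.normalDerivSum du v =
      ∑ e, (b (G.tgt e) * du e (G.len e) - b (G.src e) * du e 0) := by
  classical
  simp only [normalDerivSum, Finset.mul_sum]
  rw [Finset.sum_comm]
  refine Finset.sum_congr rfl fun e _ => ?_
  simp only [mul_add, mul_ite, mul_zero, Finset.sum_add_distrib, Finset.sum_ite_eq,
    Finset.mem_univ, if_true]
  ring

theorem sum_flux_eq_zero (hdu : ∀ v, G.normalDerivSum du v = 0) (b : G.Point → ℝ) :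
    ∑ e, (b (G.pt e (G.len e)) * du e (G.len e) - b (G.pt e 0) * du e 0) = 0 := by
  have := G.finite_vertices
  have : Fintype V := Fintype.ofFinite V
  simp only [pt_zero, pt_len]
  rw [← sum_mul_normalDerivSum fun v => b (.vertex v)]
  simp [hdu]

/-! ### Comparison with a positive solution -/

theorem IsSolution.hasDerivWithinAt_div (hφ : G.IsSolution q μ φ dφ) (hpos : ∀ x, 0 < φ x)
    {p : G.Point → ℝ} (hu : G.IsSolution p ν u du) (e : E) (s : ℝ) (hs : s ∈ Icc 0 (G.len e)) :
    HasDerivWithinAt (fun s => u (G.pt e s) / φ (G.pt e s))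
      ((du e s - dφ e s * u (G.pt e s) / φ (G.pt e s)) / φ (G.pt e s)) (Icc 0 (G.len e)) s := by
  have hne := (hpos (G.pt e s)).ne'
  refine ((hu.hasDerivWithinAt e s hs).div (hφ.hasDerivWithinAt e s hs) hne).congr_deriv ?_
  field_simp

/-- Picone's identity: the left-hand side is the derivative of `u u' - u² φ' / φ`, and the
increments of this function over the edges add up to zero by the Kirchhoff conditions. -/
theorem IsSolution.picone (hφ : G.IsSolution q μ φ dφ) (hpos : ∀ x, 0 < φ x)
    (hu : G.IsSolution q ν u du) (hνμ : ν ≤ μ) : ∀ e, ∀ s ∈ Icc 0 (G.len e),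
      (μ - ν) * u (G.pt e s) ^ 2 + (du e s - dφ e s * u (G.pt e s) / φ (G.pt e s)) ^ 2 = 0 := by
  refine eq_zero_of_hasDerivWithinAt_nonneg_of_sum_le G.len_pos
    (g := fun e s => u (G.pt e s) * (du e s - u (G.pt e s) / φ (G.pt e s) * dφ e s))
    (fun e s hs => ?_) (fun e s _ => ?_) ?_
  · have hne := (hpos (G.pt e s)).ne'
    refine ((hu.hasDerivWithinAt e s hs).mul ((hu.hasDerivWithinAt_deriv e s hs).sub
      ((hφ.hasDerivWithinAt_div hpos hu e s hs).mul
        (hφ.hasDerivWithinAt_deriv e s hs)))).congr_deriv ?_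
    simp only [Pi.mul_apply, Pi.sub_apply]
    field_simp
    ring
  · exact add_nonneg (mul_nonneg (sub_nonneg.mpr hνμ) (sq_nonneg _)) (sq_nonneg _)
  · have hu_flux := sum_flux_eq_zero hu.kirchhoff u
    have hφ_flux := sum_flux_eq_zero hφ.kirchhoff fun x => u x ^ 2 / φ x
    refine (Eq.trans ?_ (sub_eq_zero.mpr (hu_flux.trans hφ_flux.symm))).le
    rw [← Finset.sum_sub_distrib]
    exact Finset.sum_congr rfl fun e _ => by ring

theorem IsSolution.le_of_pos (hφ : G.IsSolution q μ φ dφ) (hpos : ∀ x, 0 < φ x)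
    (hu : G.IsSolution q ν u du) (hu0 : u ≠ 0) : μ ≤ ν := by
  by_contra! hlt
  refine hu0 (funext fun x => ?_)
  obtain ⟨e, s, hs, rfl⟩ := exists_pt_eq x
  have h_zero := (add_eq_zero_iff_of_nonneg (mul_nonneg (sub_pos.mpr hlt).le (sq_nonneg _))
    (sq_nonneg _)).mp (hφ.picone hpos hu hlt.le e s hs)
  simpa [(sub_pos.mpr hlt).ne'] using h_zero.1

/-- The Wronskian `φ ψ' - ψ φ'` has derivative `((p - ν) - (q - μ)) φ ψ`, and its increments over
the edges add up to zero. -/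
theorem IsSolution.lt_of_potential_lt {p ψ : G.Point → ℝ} {dψ : E → ℝ → ℝ}
    (hφ : G.IsSolution q μ φ dφ) (hφ_pos : ∀ x, 0 < φ x) (hψ : G.IsSolution p ν ψ dψ)
    (hψ_pos : ∀ x, 0 < ψ x) (hqp : q ≤ p) {x : G.Point} (hx : q x < p x) : μ < ν := by
  by_contra! hνμ
  have h_zero : ∀ e, ∀ s ∈ Icc 0 (G.len e), (p (G.pt e s) - q (G.pt e s) + (μ - ν)) *
      (φ (G.pt e s) * ψ (G.pt e s)) = 0 := by
    refine eq_zero_of_hasDerivWithinAt_nonneg_of_sum_le G.len_pos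
      (g := fun e s => φ (G.pt e s) * dψ e s - ψ (G.pt e s) * dφ e s)
      (fun e s hs => ?_) (fun e s _ => ?_) ?_
    · refine (((hφ.hasDerivWithinAt e s hs).mul (hψ.hasDerivWithinAt_deriv e s hs)).sub
        ((hψ.hasDerivWithinAt e s hs).mul (hφ.hasDerivWithinAt_deriv e s hs))).congr_deriv ?_
      ring
    · exact mul_nonneg (add_nonneg (sub_nonneg.mpr (hqp _)) (sub_nonneg.mpr hνμ))
        (mul_pos (hφ_pos _) (hψ_pos _)).le
    · have hψ_flux := sum_flux_eq_zero hψ.kirchhoff φ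
      have hφ_flux := sum_flux_eq_zero hφ.kirchhoff ψ
      refine (Eq.trans ?_ (sub_eq_zero.mpr (hψ_flux.trans hφ_flux.symm))).le
      rw [← Finset.sum_sub_distrib]
      exact Finset.sum_congr rfl fun e _ => by ring
  obtain ⟨e, s, hs, rfl⟩ := exists_pt_eq x
  have h_pos := mul_pos (add_pos_of_pos_of_nonneg (sub_pos.mpr hx) (sub_nonneg.mpr hνμ))
    (mul_pos (hφ_pos (G.pt e s)) (hψ_pos (G.pt e s)))
  exact h_pos.ne' (h_zero e s hs)

theorem IsSolution.mem_lowerBounds_of_pos (hφ : G.IsSolution q μ φ dφ) (hpos : ∀ x, 0 < φ x)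
    (hq : Continuous q) {k : ℕ} (hk : 0 < k) :
    μ ∈ lowerBounds {η : ℝ | ∃ u : Fin k → G.Point → ℝ, LinearIndependent ℝ u ∧
      ∀ i, ∃ ν ≤ η, G.IsEigenfunction q ν (u i)} := by
  rintro η ⟨u, -, hu⟩
  obtain ⟨ν, hν, h_eigen⟩ := hu ⟨0, hk⟩
  obtain ⟨du, hdu⟩ := h_eigen.exists_isSolution hq
  exact (hφ.le_of_pos hpos hdu h_eigen.1).trans hν

theorem IsSolution.eigenvalue_one_eq [Nonempty G.Point] (hφ : G.IsSolution q μ φ dφ)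
    (hpos : ∀ x, 0 < φ x) (hq : Continuous q) : G.eigenvalue q 1 = μ := by
  have hφ0 : φ ≠ 0 := fun h => (hpos (Classical.arbitrary _)).ne' (congrFun h _)
  exact IsLeast.csInf_eq ⟨⟨fun _ => φ, linearIndependent_unique_iff.mpr hφ0,
    fun _ => ⟨μ, le_rfl, hφ.isEigenfunction hq hφ0⟩⟩, hφ.mem_lowerBounds_of_pos hpos hq one_pos⟩

theorem IsSolution.eigenvalue_two_le {x : G.Point} (hφ : G.IsSolution q μ φ dφ)
    (hpos : ∀ x, 0 < φ x) (hq : Continuous q) (hu : G.IsSolution q ν u du) (hu0 : u ≠ 0)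
    (hx : u x = 0) : G.eigenvalue q 2 ≤ ν := by
  have hφ0 : φ ≠ 0 := fun h => (hpos x).ne' (congrFun h x)
  have h_indep : LinearIndependent ℝ ![φ, u] := by
    refine LinearIndependent.pair_iff.mpr fun a b hab => ?_
    obtain rfl : a = 0 := by simpa [hx, (hpos x).ne'] using congrFun hab x
    rw [zero_smul, zero_add] at hab
    exact ⟨rfl, (smul_eq_zero.mp hab).resolve_right hu0⟩
  refine csInf_le ⟨μ, hφ.mem_lowerBounds_of_pos hpos hq two_pos⟩
    ⟨![φ, u], h_indep, Fin.forall_fin_two.mpr ⟨?_, ?_⟩⟩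
  · exact ⟨μ, hφ.le_of_pos hpos hu hu0, hφ.isEigenfunction hq hφ0⟩
  · exact ⟨ν, le_rfl, hu.isEigenfunction hq hu0⟩

/-! ### Cutting off a solution that vanishes on an edge -/

/-- The function `u`, multiplied by `κ v` at the vertex `v` and by `κ (src e)` on the edge `e`. It
is meant for `κ` that take the same value at both ends of every edge on which `u` does not vanish
identically; for an indicator function `κ` it is then a cutoff of `u`. -/
def vertexScale (κ : V → ℝ) (u : G.Point → ℝ) : G.Point → ℝ :=
  glue (fun v => κ v * u (.vertex v)) fun e s => κ (G.src e) * u (G.pt e s)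

section vertexScale

variable {κ : V → ℝ}
  (hκ : ∀ e, κ (G.src e) = κ (G.tgt e) ∨ ∀ s ∈ Icc 0 (G.len e), u (G.pt e s) = 0)
include hκ

omit [Fintype E] in
theorem vertexScale_pt (e : E) {s : ℝ} (hs : s ∈ Icc 0 (G.len e)) :
    vertexScale κ u (G.pt e s) = κ (G.src e) * u (G.pt e s) := by
  refine glue_pt (by rw [pt_zero]) ?_ hs
  rcases hκ e with h | h
  · rw [pt_len, h]
  · rw [← pt_len, h _ (len_mem_Icc_len e), mul_zero, mul_zero]

theorem IsSolution.vertexScale (hu : G.IsSolution q μ u du) :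
    G.IsSolution q μ (vertexScale κ u) fun e s => κ (G.src e) * du e s where
  hasDerivWithinAt e s hs := ((hu.hasDerivWithinAt e s hs).const_mul _).congr
    (fun _ hr => vertexScale_pt hκ e hr) (vertexScale_pt hκ e hs)
  hasDerivWithinAt_deriv e s hs := by
    rw [vertexScale_pt hκ e hs, mul_left_comm]
    exact (hu.hasDerivWithinAt_deriv e s hs).const_mul _
  kirchhoff v := by
    have h_tgt : ∀ e, κ (G.src e) * du e (G.len e) = κ (G.tgt e) * du e (G.len e) := by
      intro e
      rcases hκ e with h | h
      · rw [h]
      · rw [hu.deriv_eq_zero_of_eq_zero h (len_mem_Icc_len e), mul_zero, mul_zero]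
    have h_scale := congrArg (κ v * ·) (hu.kirchhoff v)
    simp only [normalDerivSum, Finset.mul_sum, mul_zero] at h_scale ⊢
    refine (Finset.sum_congr rfl fun e _ => ?_).trans h_scale
    grind

end vertexScale

theorem IsTree.exists_isSolution_isPendant_of_src_notMem_side (hG : G.IsTree)
    (hu : G.IsSolution q μ u du) {f : E} (huf : ∀ s ∈ Icc 0 (G.len f), u (G.pt f s) = 0) {a b : V}
    (hf : G.ends f = s(a, b)) {e : E} {s : ℝ} (hs : s ∈ Icc 0 (G.len e))
    (hne : u (G.pt e s) ≠ 0) (he : G.src e ∉ G.side f b) :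
    ∃ w e' u' du', G.IsPendant w e' ∧ G.IsSolution q μ u' du' ∧ u' ≠ 0 ∧
      ∀ s ∈ Icc 0 (G.len e'), u' (G.pt e' s) = 0 := by
  classical
  obtain ⟨w, hw, e', he'⟩ := hG.exists_isPendant_mem_side hf
  have hκ : ∀ e, (G.side f b)ᶜ.indicator (1 : V → ℝ) (G.src e) =
      (G.side f b)ᶜ.indicator 1 (G.tgt e) ∨ ∀ s ∈ Icc 0 (G.len e), u (G.pt e s) = 0 := by
    intro e
    by_cases hef : e = f
    · exact .inr (hef ▸ huf)
    · simp only [indicator_apply, mem_compl_iff, hG.mem_side_iff (b := b) rfl hef, Pi.one_apply,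
        true_or]
  refine ⟨w, e', _, _, he', hu.vertexScale hκ, fun h => hne ?_, fun r hr => ?_⟩
  · simpa [vertexScale_pt hκ e hs, he] using congrFun h (G.pt e s)
  · rw [vertexScale_pt hκ e' hr]
    by_cases hef : e' = f
    · rw [(hef ▸ huf : ∀ s ∈ Icc 0 (G.len e'), u (G.pt e' s) = 0) r hr, mul_zero]
    · have h_src : G.src e' ∈ G.side f b := by
        rcases Sym2.mem_iff.mp ((he'.incident_iff e').mpr rfl) with h | h
        · exact h ▸ hw
        · exact (hG.mem_side_iff rfl hef).mpr (h ▸ hw)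
      rw [indicator_of_notMem (notMem_compl_iff.mpr h_src), zero_mul]

theorem IsTree.exists_isSolution_isPendant (hG : G.IsTree) (hu : G.IsSolution q μ u du)
    (hu0 : u ≠ 0) {f : E} (huf : ∀ s ∈ Icc 0 (G.len f), u (G.pt f s) = 0) :
    ∃ w e u' du', G.IsPendant w e ∧ G.IsSolution q μ u' du' ∧ u' ≠ 0 ∧
      ∀ s ∈ Icc 0 (G.len e), u' (G.pt e s) = 0 := by
  obtain ⟨x, hx⟩ := Function.ne_iff.mp hu0
  obtain ⟨e, s, hs, rfl⟩ := exists_pt_eq x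
  by_cases h_src : G.src e ∈ G.side f (G.src f)
  · exact hG.exists_isSolution_isPendant_of_src_notMem_side hu huf rfl hs hx
      (Set.disjoint_left.mp (hG.disjoint_side rfl) h_src)
  · exact hG.exists_isSolution_isPendant_of_src_notMem_side hu huf Sym2.eq_swap hs hx h_src

end solutions

/-! ### The ground state of a small potential -/

/-- Data encoding a function on the metric graph that has bounded continuous second derivatives on
the edges: these second derivatives, together with the values at the vertices. -/
abbrev EdgeVertexData (V E : Type*) : Type _ := (E → ℝ →ᵇ ℝ) × (V → ℝ)

section EdgeVertexData

/-- The derivative at the end `0` of the edge `e` of the function encoded by the given data. -/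
def edgeSlope (G : MetricGraph V E) (e : E) : EdgeVertexData V E →L[ℝ] ℝ :=
  (G.len e)⁻¹ • ((.proj (G.tgt e) - .proj (G.src e)) ∘L .snd ℝ _ _ -
    BoundedContinuousFunction.evalCLM ℝ (G.len e) ∘L primitive (G.len_pos e).le ∘L
      primitive (G.len_pos e).le ∘L .proj e ∘L .fst ℝ _ _)

/-- The derivatives along the edges of the function encoded by the given data. -/
def edgeDeriv (G : MetricGraph V E) : EdgeVertexData V E →L[ℝ] (E → ℝ →ᵇ ℝ) :=
  .pi fun e => (G.edgeSlope e).smulRight 1 + primitive (G.len_pos e).le ∘L .proj e ∘L .fst ℝ _ _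

/-- The function encoded by the given data, in the coordinates of the edges. -/
def edgeProfile (G : MetricGraph V E) : EdgeVertexData V E →L[ℝ] (E → ℝ →ᵇ ℝ) :=
  .pi fun e => (.proj (G.src e) ∘L .snd ℝ _ _).smulRight 1 +
    primitive (G.len_pos e).le ∘L .proj e ∘L G.edgeDeriv

variable (p : EdgeVertexData V E) (e : E)

theorem edgeSlope_apply : G.edgeSlope e p = (p.2 (G.tgt e) - p.2 (G.src e) -
    primitive (G.len_pos e).le (primitive (G.len_pos e).le (p.1 e)) (G.len e)) / G.len e := by
  simp [edgeSlope, div_eq_inv_mul]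

theorem edgeDeriv_apply (s : ℝ) :
    G.edgeDeriv p e s = G.edgeSlope e p + primitive (G.len_pos e).le (p.1 e) s := by
  simp [edgeDeriv]

theorem edgeProfile_apply (s : ℝ) :
    G.edgeProfile p e s = p.2 (G.src e) + primitive (G.len_pos e).le (G.edgeDeriv p e) s := by
  simp [edgeProfile]

theorem edgeProfile_zero : G.edgeProfile p e 0 = p.2 (G.src e) := by
  rw [edgeProfile_apply, primitive_left, add_zero]

theorem edgeProfile_len : G.edgeProfile p e (G.len e) = p.2 (G.tgt e) := by
  have h_deriv : G.edgeDeriv p e = G.edgeSlope e p • 1 + primitive (G.len_pos e).le (p.1 e) := by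
    ext s
    simp [edgeDeriv_apply]
  rw [edgeProfile_apply, h_deriv, map_add, map_smul, BoundedContinuousFunction.add_apply,
    BoundedContinuousFunction.smul_apply, primitive_one (len_mem_Icc_len e), edgeSlope_apply,
    smul_eq_mul, sub_zero, div_mul_cancel₀ _ (G.len_pos e).ne']
  ring

variable {e} {s : ℝ} (hs : s ∈ Icc 0 (G.len e))
include hs

theorem hasDerivWithinAt_edgeDeriv :
    HasDerivWithinAt (G.edgeDeriv p e) (p.1 e s) (Icc 0 (G.len e)) s := by
  rw [funext (edgeDeriv_apply p e)]
  exact (hasDerivWithinAt_primitive _ hs).const_add _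

theorem hasDerivWithinAt_edgeProfile :
    HasDerivWithinAt (G.edgeProfile p e) (G.edgeDeriv p e s) (Icc 0 (G.len e)) s := by
  rw [funext (edgeProfile_apply p e)]
  exact (hasDerivWithinAt_primitive _ hs).const_add _

theorem glue_edgeProfile_pt :
    glue p.2 (fun e => G.edgeProfile p e) (G.pt e s) = G.edgeProfile p e s :=
  glue_pt (edgeProfile_zero p e) (edgeProfile_len p e) hs

end EdgeVertexData

theorem edgeDeriv_one : G.edgeDeriv (0, 1) = 0 := by
  ext e s
  simp [edgeDeriv_apply, edgeSlope_apply]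

theorem edgeProfile_one : G.edgeProfile (0, 1) = 1 := by
  ext e s
  simp [edgeProfile_apply, edgeDeriv_one]

section normalDerivSum

variable [Fintype E]

open Classical in
/-- The map `normalDerivSum`, restricted to bounded continuous derivatives on the edges. -/
def normalDerivSumCLM (G : MetricGraph V E) : (E → ℝ →ᵇ ℝ) →L[ℝ] (V → ℝ) :=
  .pi fun v => ∑ e, ((if G.src e = v then -(BoundedContinuousFunction.evalCLM ℝ 0 ∘L .proj e)
    else 0) + (if G.tgt e = v then BoundedContinuousFunction.evalCLM ℝ (G.len e) ∘L .proj e else 0))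

theorem normalDerivSumCLM_apply (du : E → ℝ →ᵇ ℝ) (v : V) :
    G.normalDerivSumCLM du v = G.normalDerivSum (fun e => du e) v := by
  simp only [normalDerivSumCLM, normalDerivSum, ContinuousLinearMap.coe_pi', sum_apply]
  refine Finset.sum_congr rfl fun e _ => ?_
  split_ifs <;> simp

theorem sum_normalDerivSumCLM_edgeDeriv [Fintype V] (p : EdgeVertexData V E) :
    ∑ v, G.normalDerivSumCLM (G.edgeDeriv p) v =
      ∑ e, primitive (G.len_pos e).le (p.1 e) (G.len e) := by
  have h_sum := sum_mul_normalDerivSum (G := G) 1 fun e => G.edgeDeriv p e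
  simp only [Pi.one_apply, one_mul] at h_sum
  simp only [normalDerivSumCLM_apply, h_sum, edgeDeriv_apply, primitive_left, add_zero,
    add_sub_cancel_left]

theorem eq_of_normalDerivSumCLM_edgeDeriv_eq_zero (hG : G.toSimpleGraph.Connected) {b : V → ℝ}
    (hb : G.normalDerivSumCLM (G.edgeDeriv (0, b)) = 0) (v w : V) : b v = b w := by
  have := G.finite_vertices
  have : Fintype V := Fintype.ofFinite V
  have h_flux := sum_mul_normalDerivSum (G := G) b fun e => G.edgeDeriv (0, b) e
  simp only [← normalDerivSumCLM_apply, hb, Pi.zero_apply, mul_zero, Finset.sum_const_zero,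
    edgeDeriv_apply, edgeSlope_apply, map_zero, BoundedContinuousFunction.coe_zero, sub_zero,
    add_zero, ← sub_mul] at h_flux
  have h_nonneg : ∀ e ∈ Finset.univ,
      0 ≤ (b (G.tgt e) - b (G.src e)) * ((b (G.tgt e) - b (G.src e)) / G.len e) := fun e _ => by
    rw [← mul_div_assoc]
    exact div_nonneg (mul_self_nonneg _) (G.len_pos e).le
  refine eq_of_forall_src_eq_tgt hG (fun e => ?_) v w
  have h_edge := (Finset.sum_eq_zero_iff_of_nonneg h_nonneg).mp h_flux.symm e (Finset.mem_univ e)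
  rw [← mul_div_assoc, div_eq_zero_iff, or_iff_left (G.len_pos e).ne', mul_self_eq_zero] at h_edge
  exact (sub_eq_zero.mp h_edge).symm

theorem exists_normalDerivSumCLM_edgeDeriv_eq [Fintype V] (hG : G.toSimpleGraph.Connected)
    {r : V → ℝ} (hr : ∑ v, r v = 0) : ∃ b, G.normalDerivSumCLM (G.edgeDeriv (0, b)) = r :=
  have := hG.nonempty
  exists_eq_of_sum_eq_zero (G.normalDerivSumCLM ∘L G.edgeDeriv ∘L .inr ℝ _ _).toLinearMap
    (fun b => (sum_normalDerivSumCLM_edgeDeriv (G := G) (0, b)).trans (by simp))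
    (fun _ => eq_of_normalDerivSumCLM_edgeDeriv_eq_zero hG) hr

/-- At the constant function `1`, the linearization of the eigenvalue problem for the Laplacian with
Kirchhoff conditions is surjective: the eigenvalue provides the one missing dimension. -/
theorem exists_edgeVertexData_sub_smul_eq (hG : G.toSimpleGraph.Connected) (y : E → ℝ →ᵇ ℝ)
    (k : V → ℝ) : ∃ (p : EdgeVertexData V E) (μ : ℝ),
      p.1 + μ • 1 = y ∧ G.normalDerivSumCLM (G.edgeDeriv p) = k := by
  have := G.finite_vertices
  have : Fintype V := Fintype.ofFinite V
  have h_len : ∑ e, G.len e ≠ 0 := by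
    obtain ⟨e, -⟩ := G.exists_incident hG.nonempty.some
    exact (Finset.sum_pos (fun e _ => G.len_pos e) ⟨e, Finset.mem_univ e⟩).ne'
  let μ : ℝ := (∑ e, primitive (G.len_pos e).le (y e) (G.len e) - ∑ v, k v) / ∑ e, G.len e
  have hμ : ∑ v, (k - G.normalDerivSumCLM (G.edgeDeriv (y - μ • 1, 0))) v = 0 := by
    simp only [Pi.sub_apply, Finset.sum_sub_distrib, sum_normalDerivSumCLM_edgeDeriv]
    simp [primitive_one (len_mem_Icc_len _), Finset.sum_sub_distrib, ← Finset.mul_sum, μ, h_len]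
  obtain ⟨b, hb⟩ := exists_normalDerivSumCLM_edgeDeriv_eq hG hμ
  refine ⟨(y - μ • 1, b), μ, sub_add_cancel _ _, ?_⟩
  have h_add : ((y - μ • 1, b) : EdgeVertexData V E) = (0, b) + (y - μ • 1, 0) := by simp
  rw [h_add, map_add, map_add, hb, sub_add_cancel]

theorem isSolution_glue_edgeProfile {p : EdgeVertexData V E} {q : G.Point → ℝ} {μ : ℝ}
    (hp : ∀ e, ∀ s ∈ Icc 0 (G.len e), p.1 e s = (q (G.pt e s) - μ) * G.edgeProfile p e s)
    (h_kirchhoff : G.normalDerivSumCLM (G.edgeDeriv p) = 0) :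
    G.IsSolution q μ (glue p.2 fun e => G.edgeProfile p e) fun e => G.edgeDeriv p e where
  hasDerivWithinAt _ _ hs := (hasDerivWithinAt_edgeProfile p hs).congr
    (fun _ hr => glue_edgeProfile_pt p hr) (glue_edgeProfile_pt p hs)
  hasDerivWithinAt_deriv e s hs := by
    rw [glue_edgeProfile_pt p hs, ← hp e s hs]
    exact hasDerivWithinAt_edgeDeriv p hs
  kirchhoff v := by rw [← normalDerivSumCLM_apply, h_kirchhoff, Pi.zero_apply]

theorem glue_edgeProfile_pos {p : EdgeVertexData V E} (hp : ‖G.edgeProfile p - 1‖ < 1)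
    (x : G.Point) : 0 < glue p.2 (fun e => G.edgeProfile p e) x := by
  obtain ⟨e, s, hs, rfl⟩ := exists_pt_eq x
  rw [glue_edgeProfile_pt p hs]
  have h_dist : |G.edgeProfile p e s - 1| < 1 :=
    (((G.edgeProfile p - 1) e).norm_coe_le_norm s).trans_lt
      ((norm_le_pi_norm (G.edgeProfile p - 1) e).trans_lt hp)
  linarith [(abs_lt.mp h_dist).1]

theorem eventually_exists_isSolution_smul_pos (hG : G.toSimpleGraph.Connected)
    {q : G.Point → ℝ} (hq : Continuous q) :
    ∀ᶠ t in 𝓝 (0 : ℝ), ∃ μ φ dφ, (∀ x, 0 < φ x) ∧ G.IsSolution (t • q) μ φ dφ := by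
  have := G.finite_vertices
  have : Fintype V := Fintype.ofFinite V
  choose Q hQ using fun e => exists_boundedContinuousFunction_eqOn_Icc (G.len_pos e).le
    (hq.comp_continuousOn (continuousOn_pt e))
  let A : EdgeVertexData V E →L[ℝ] EdgeVertexData V E :=
    (ContinuousLinearMap.fst ℝ _ _).prod (G.normalDerivSumCLM ∘L G.edgeDeriv)
  let J : EdgeVertexData V E →L[ℝ] EdgeVertexData V E := (-G.edgeProfile).prod 0
  let B : EdgeVertexData V E →L[ℝ] EdgeVertexData V E :=
    (-(ContinuousLinearMap.mul ℝ _ Q ∘L G.edgeProfile)).prod 0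
  have hA : A (0, 1) = 0 := Prod.ext rfl <| by
    simp only [A, ContinuousLinearMap.prod_apply, ContinuousLinearMap.comp_apply, edgeDeriv_one,
      map_zero, Prod.snd_zero]
  have h_surj : Function.Surjective
      fun p : EdgeVertexData V E × ℝ => A p.1 - p.2 • J (0, 1) := by
    rintro ⟨y, k⟩
    obtain ⟨p, μ, rfl, rfl⟩ := exists_edgeVertexData_sub_smul_eq hG y k
    exact ⟨(p, μ), by simp [A, J, edgeProfile_one]⟩
  have hU : {p | ‖G.edgeProfile p - 1‖ < 1} ∈ 𝓝 ((0, 1) : EdgeVertexData V E) := by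
    refine (isOpen_lt (by fun_prop) continuous_const).mem_nhds ?_
    simp [edgeProfile_one]
  filter_upwards [eventually_exists_perturbed_eigenvector A J B hA h_surj hU]
    with t ⟨μ, p, hpU, hp⟩
  obtain ⟨h_eq, h_kirchhoff⟩ := Prod.ext_iff.mp hp
  refine ⟨μ, _, _, glue_edgeProfile_pos hpU,
    isSolution_glue_edgeProfile (p := p) (fun e s hs => ?_) ?_⟩
  · have h_eq_s : p.1 e s + t * -(Q e s * G.edgeProfile p e s) = μ * -G.edgeProfile p e s := by
      simpa [A, J, B] using DFunLike.congr_fun (congrFun h_eq e) s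
    rw [Pi.smul_apply, smul_eq_mul, ← Function.comp_apply (f := q), ← hQ e hs]
    linear_combination h_eq_s
  · simpa [A, J, B] using h_kirchhoff

end normalDerivSum

/-! ### The gap for a small potential on a pendant edge -/

section gap

variable [Fintype E] {μ ν t : ℝ} {u φ : G.Point → ℝ} {du dφ : E → ℝ → ℝ} {w : V} {f : E}

theorem eigenvalue_zero_one [Nonempty G.Point] : G.eigenvalue 0 1 = 0 :=
  isSolution_one.eigenvalue_one_eq (fun _ => one_pos) continuous_const

theorem IsSolution.gap_le {q : G.Point → ℝ} (hφ : G.IsSolution q μ φ dφ) (hpos : ∀ x, 0 < φ x)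
    (hq : Continuous q) (hu : G.IsSolution q ν u du) (hu0 : u ≠ 0) {x : G.Point} (hx : u x = 0) :
    G.gap q ≤ ν - μ := by
  have : Nonempty G.Point := ⟨x⟩
  rw [gap, hφ.eigenvalue_one_eq hpos hq]
  exact sub_le_sub_right (hφ.eigenvalue_two_le hpos hq hu hu0 hx) μ

theorem IsPendant.pos_of_isSolution_smul_pendantTent (hf : G.IsPendant w f) (ht : 0 < t)
    (hφ : G.IsSolution (t • G.pendantTent w f) μ φ dφ) (hpos : ∀ x, 0 < φ x) : 0 < μ := by
  have h_le : (0 : G.Point → ℝ) ≤ t • G.pendantTent w f :=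
    smul_nonneg ht.le fun x => (hf.pendantTent_mem_Icc x).1
  refine isSolution_one.lt_of_potential_lt (fun _ => one_pos) hφ hpos h_le (x := .vertex w) ?_
  simpa [pendantTent_vertex_self] using ht

theorem IsPendant.isSolution_smul_pendantTent (hf : G.IsPendant w f) (hu : G.IsSolution 0 ν u du)
    (huf : ∀ s ∈ Icc 0 (G.len f), u (G.pt f s) = 0) (t : ℝ) :
    G.IsSolution (t • G.pendantTent w f) ν u du := by
  refine hu.congr_potential fun x => ?_
  obtain ⟨e, s, hs, rfl⟩ := exists_pt_eq x
  by_cases he : e = f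
  · rw [he] at hs ⊢
    rw [huf s hs, mul_zero, mul_zero]
  · rw [Pi.smul_apply, hf.pendantTent_pt_of_ne he hs, smul_zero, Pi.zero_apply]

end gap

end MetricGraph

end

theorem mainTheorem6 {V E : Type*} [Fintype E] (G : MetricGraph V E) (hG : G.IsTree)
    (hvanish : ∃ u : G.Point → ℝ, G.IsEigenfunction 0 (G.eigenvalue 0 2) u ∧
      ∃ e : E, ∀ s ∈ Set.Icc (0 : ℝ) (G.len e), u (G.pt e s) = 0)
    (M : ℝ) (hM : 0 < M) :
    ¬ IsMinOn G.gap (G.convexClass M) 0 := by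
  obtain ⟨u₀, hu₀, f, hf⟩ := hvanish
  obtain ⟨du₀, hdu₀⟩ := hu₀.exists_isSolution continuous_const
  obtain ⟨w, e, u, du, he, hu, hu0, hue⟩ := hG.exists_isSolution_isPendant hdu₀ hu₀.1 hf
  have h_tent := he.continuous_pendantTent
  have h_ground := MetricGraph.eventually_exists_isSolution_smul_pos hG.2.2.connected h_tent
  obtain ⟨t, ⟨μ, φ, dφ, hpos, hφ⟩, ht, htM⟩ :=
    ((h_ground.filter_mono nhdsWithin_le_nhds).and (Ioc_mem_nhdsGT hM)).exists
  have hμ : 0 < μ := he.pos_of_isSolution_smul_pendantTent ht hφ hpos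
  have h_gap_tent : G.gap (t • G.pendantTent w e) ≤ G.eigenvalue 0 2 - μ :=
    hφ.gap_le hpos (h_tent.const_smul t) (he.isSolution_smul_pendantTent hu hue t) hu0
      (hue 0 (MetricGraph.zero_mem_Icc_len e))
  have : Nonempty G.Point := ⟨.vertex w⟩
  have h_gap_zero : G.gap 0 = G.eigenvalue 0 2 := by
    rw [MetricGraph.gap, MetricGraph.eigenvalue_zero_one, sub_zero]
  intro h_min
  have h_le := isMinOn_iff.mp h_min _ (he.smul_pendantTent_mem_convexClass ht.le htM)
  linarith
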